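/- Let $B$ be an additive category (a preadditive category with chosen finite products), let $X$ be a category with chosen finite products, and let $P\colon X\to B$ be a cartesian monoidal opfibration: $P$ is a Grothendieck opfibration with a chosen cleavage ($\hat f\colon x\to f_*x$ denotes the chosen cocartesian lifting of $f\colon a\to b$ at an object $x$ of the fibre $F(a)=P^{-1}(a)$), $P$ strictly preserves the chosen terminal object $I$ and the chosen binary products, and the product of two $P$-cocartesian arrows is $P$-cocartesian. Let $F\colon B\to\mathbf{CAT}$ be the associated pseudofunctor, $a\mapsto F(a)$, $f\mapsto f_*$. Let $\mathbf{SCG}$ be the 2-category of symmetric 2-groups (symmetric monoidal categories that are groupoids and in which every object is weakly invertible for the tensor product), strong symmetric monoidal functors and monoidal natural transformations, with its forgetful 2-functor $U\colon\mathbf{SCG}\to\mathbf{CAT}$. Then $F$ factors through $\mathbf{SCG}$, i.e. there is a pseudofunctor $G\colon B\to\mathbf{SCG}$ with $U\circ G=F$, if and only if every fibre of $P$ is a groupoid. Moreover, every fibre of $P$ is a groupoid if and only if $F$ factors through $\mathbf{SCG}$ by means of the canonical structures: on $F(a)$ the tensor product is $x\otimes y=m_*(x\times y)$ and the unit object is $e_*(I)$,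 where $m\colon a\times a\to a$ and $e\colon I_B\to a$ are the addition and the zero of $a$; the associativity, unit and symmetry constraints of $F(a)$ are those for which the chosen liftings $\hat m\colon x\times y\to x\otimes y$ and $\hat e\colon I\to e_*(I)$ make the inclusion $F(a)\to X$ a lax symmetric monoidal functor to $(X,\times,I)$; and the monoidal structure of each $f_*$ is the one for which the liftings $\hat f$ form a monoidal natural transformation. -/

import Mathlib

open CategoryTheory MonoidalCategory CartesianMonoidalCategory

universe v₁ v₂ u₁ u₂ v u

/-! ### The 2-category of symmetric 2-groups -/

/-- A symmetric 2-group: a symmetric monoidal category which is a groupoid and in which every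
object is weakly invertible for the tensor product. -/
structure SCG where
  /-- The underlying type of objects. -/
  carrier : Type u
  [category : Category.{v} carrier]
  [monoidal : MonoidalCategory carrier]
  [symmetric : SymmetricCategory carrier]
  isGroupoid : IsGroupoid carrier
  exists_inverse (x : carrier) :
    ∃ y : carrier, Nonempty (x ⊗ y ≅ 𝟙_ carrier) ∧ Nonempty (y ⊗ x ≅ 𝟙_ carrier)

namespace SCG

attribute [instance] SCG.category SCG.monoidal SCG.symmetric

/-- A morphism of symmetric 2-groups: a strong symmetric monoidal functor. -/
structure Hom (G H : SCG.{v, u}) where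
  /-- The underlying functor. -/
  functor : G.carrier ⥤ H.carrier
  [braided : functor.Braided]

attribute [instance] Hom.braided

/-- A 2-cell between morphisms of symmetric 2-groups: a monoidal natural transformation. -/
@[ext]
structure Hom₂ {G H : SCG.{v, u}} (f g : Hom G H) where
  /-- The underlying natural transformation. -/
  natTrans : f.functor ⟶ g.functor
  isMonoidal : NatTrans.IsMonoidal natTrans

instance quiver : Quiver SCG.{v, u} where
  Hom G H := Hom G H

instance categoryStruct : CategoryStruct SCG.{v, u} where
  id G := Hom.mk (𝟭 G.carrier)
  comp f g := Hom.mk (Hom.functor f ⋙ Hom.functor g)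

instance quiver₂ {G H : SCG.{v, u}} : Quiver (G ⟶ H) where
  Hom f g := Hom₂ f g

/-- Two 2-cells with the same underlying natural transformation are equal. -/
theorem hom₂_ext {G H : SCG.{v, u}} {f g : G ⟶ H} {α β : f ⟶ g}
    (h : ∀ x, (Hom₂.natTrans α).app x = (Hom₂.natTrans β).app x) : α = β :=
  Hom₂.ext (NatTrans.ext (funext h))

instance homCategory {G H : SCG.{v, u}} : Category (G ⟶ H) where
  id f := Hom₂.mk (𝟙 (Hom.functor f)) inferInstance
  comp α β := Hom₂.mk (Hom₂.natTrans α ≫ Hom₂.natTrans β)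
    (have := Hom₂.isMonoidal α; have := Hom₂.isMonoidal β; inferInstance)
  id_comp α := Hom₂.ext (Category.id_comp (Hom₂.natTrans α))
  comp_id α := Hom₂.ext (Category.comp_id (Hom₂.natTrans α))
  assoc α β γ :=
    Hom₂.ext (Category.assoc (Hom₂.natTrans α) (Hom₂.natTrans β) (Hom₂.natTrans γ))

/-- An invertible 2-cell from a monoidal natural isomorphism. -/
def isoMk {G H : SCG.{v, u}} {f g : G ⟶ H} (e : Hom.functor f ≅ Hom.functor g)
    (he : NatTrans.IsMonoidal e.hom) : f ≅ g where
  hom := Hom₂.mk e.hom he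
  inv := Hom₂.mk e.inv inferInstance
  hom_inv_id := Hom₂.ext e.hom_inv_id
  inv_hom_id := Hom₂.ext e.inv_hom_id

/-- The 2-category of symmetric 2-groups, strong symmetric monoidal functors and monoidal natural
transformations. -/
instance bicategory : Bicategory SCG.{v, u} where
  homCategory _ _ := homCategory
  whiskerLeft f _ _ η := Hom₂.mk (Functor.whiskerLeft (Hom.functor f) (Hom₂.natTrans η))
    (have := Hom₂.isMonoidal η; NatTrans.IsMonoidal.whiskerLeft _)
  whiskerRight η h := Hom₂.mk (Functor.whiskerRight (Hom₂.natTrans η) (Hom.functor h))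
    (have := Hom₂.isMonoidal η; NatTrans.IsMonoidal.whiskerRight _)
  associator f g h := isoMk (Functor.associator (Hom.functor f) (Hom.functor g) (Hom.functor h))
    (inferInstanceAs (NatTrans.IsMonoidal
      (Functor.associator (Hom.functor f) (Hom.functor g) (Hom.functor h)).hom))
  leftUnitor f := isoMk (Functor.leftUnitor (Hom.functor f))
    (inferInstanceAs (NatTrans.IsMonoidal (Functor.leftUnitor (Hom.functor f)).hom))
  rightUnitor f := isoMk (Functor.rightUnitor (Hom.functor f))
    (inferInstanceAs (NatTrans.IsMonoidal (Functor.rightUnitor (Hom.functor f)).hom))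
  whiskerLeft_id _ _ := hom₂_ext fun _ => rfl
  whiskerLeft_comp _ _ _ _ _ _ := hom₂_ext fun _ => rfl
  id_whiskerLeft _ := hom₂_ext fun _ => ((Category.id_comp _).trans (Category.comp_id _)).symm
  comp_whiskerLeft _ _ _ _ _ := hom₂_ext fun _ =>
    ((Category.id_comp _).trans (Category.comp_id _)).symm
  id_whiskerRight _ h := hom₂_ext fun _ => (Hom.functor h).map_id _
  comp_whiskerRight _ _ h := hom₂_ext fun _ => (Hom.functor h).map_comp _ _
  whiskerRight_id _ := hom₂_ext fun _ => ((Category.id_comp _).trans (Category.comp_id _)).symm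
  whiskerRight_comp _ _ _ := hom₂_ext fun _ =>
    ((Category.id_comp _).trans (Category.comp_id _)).symm
  whisker_assoc _ _ _ _ _ := hom₂_ext fun _ =>
    ((Category.id_comp _).trans (Category.comp_id _)).symm
  whisker_exchange η θ := hom₂_ext fun x =>
    ((Hom₂.natTrans θ).naturality ((Hom₂.natTrans η).app x)).symm
  pentagon f g h i := Hom₂.ext
    (Functor.pentagon (Hom.functor f) (Hom.functor g) (Hom.functor h) (Hom.functor i))
  triangle f g := Hom₂.ext (Functor.triangle (Hom.functor f) (Hom.functor g))

theorem eqToHom_natTrans {G H : SCG.{v, u}} {f g : G ⟶ H} (h : f = g) :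
    Hom₂.natTrans (eqToHom h) = eqToHom (congrArg Hom.functor h) := by
  subst h
  rfl

/-- The forgetful 2-functor from symmetric 2-groups to categories. -/
def forget : Pseudofunctor SCG.{v, u} Cat.{v, u} where
  obj G := Cat.of G.carrier
  map f := (Hom.functor f).toCatHom
  map₂ η := (Hom₂.natTrans η).toCatHom₂
  map₂_id _ := rfl
  map₂_comp _ _ := rfl
  mapId _ := Iso.refl _
  mapComp _ _ := Iso.refl _
  map₂_whisker_left _ _ _ _ := ((Category.id_comp _).trans (Category.comp_id _)).symm
  map₂_whisker_right _ _ := ((Category.id_comp _).trans (Category.comp_id _)).symm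
  map₂_associator f g h := Cat.Hom₂.ext (NatTrans.ext (funext fun x => by
    have e : (Hom.functor h).map (𝟙 ((Hom.functor g).obj ((Hom.functor f).obj x))) = 𝟙 _ :=
      (Hom.functor h).map_id _
    refine (((Category.id_comp _).trans (congrArg (· ≫ _) e)).trans ?_).symm
    exact (Category.id_comp _).trans ((Category.id_comp _).trans (Category.comp_id _))))
  map₂_left_unitor f := Cat.Hom₂.ext (NatTrans.ext (funext fun x => by
    have e : (Hom.functor f).map (𝟙 x) = 𝟙 _ := (Hom.functor f).map_id _
    exact (((Category.id_comp _).trans (congrArg (· ≫ _) e)).trans (Category.id_comp _)).symm))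
  map₂_right_unitor _ := Cat.Hom₂.ext (NatTrans.ext (funext fun _ =>
    ((Category.id_comp _).trans (Category.id_comp _)).symm))

end SCG

theorem pseudofunctor_ext_of_toPrelaxFunctorStruct_eq
    {D : Type*} [Bicategory D] {E : Type*} [Bicategory E] {F G : Pseudofunctor D E}
    (h : F.toPrelaxFunctorStruct = G.toPrelaxFunctorStruct) (hId : F.mapId ≍ G.mapId)
    (hComp : @F.mapComp ≍ @G.mapComp) : F = G := by
  obtain ⟨⟨F, _, _⟩, _, _, _, _, _, _, _⟩ := F
  obtain ⟨⟨G, _, _⟩, _, _, _, _, _, _, _⟩ := G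
  cases h
  cases hId
  cases hComp
  rfl

/-! ### Cloven opfibrations and their pseudofunctors -/

section

variable {B : Type u₁} [Category.{v₁} B] {X : Type u₂} [Category.{v₂} X]

/-- The inclusion of the (strict) fibre of `P` over `a` into the total category. -/
abbrev fibreIncl (P : X ⥤ B) (a : B) : P.Fiber a ⥤ X := Functor.Fiber.fiberInclusion

/-- A cleavage of a functor `P : X ⥤ B`, exhibiting it as a (cloven) Grothendieck opfibration: a
choice, for every arrow `f : a ⟶ b` of `B` and every object `x` of the fibre over `a`, of a
`P`-cocartesian lifting of `f` with domain `x`. -/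
structure OpCleavage (P : X ⥤ B) where
  /-- The codomain `f_* x` of the chosen lifting. -/
  obj {a b : B} (f : a ⟶ b) (x : P.Fiber a) : P.Fiber b
  /-- The chosen lifting `x ⟶ f_* x` of `f`. -/
  lift {a b : B} (f : a ⟶ b) (x : P.Fiber a) :
    (fibreIncl P a).obj x ⟶ (fibreIncl P b).obj (obj f x)
  isCocartesian {a b : B} (f : a ⟶ b) (x : P.Fiber a) : P.IsStronglyCocartesian f (lift f x)

namespace OpCleavage

attribute [instance] OpCleavage.isCocartesian

variable {P : X ⥤ B} (c : OpCleavage P)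

/-- Vertical arrows out of the codomain of a lifting are determined by their restriction along
the lifting. -/
theorem hom_ext {a b : B} (f : a ⟶ b) (x : P.Fiber a) {y : P.Fiber b} {φ ψ : c.obj f x ⟶ y}
    (h : c.lift f x ≫ (fibreIncl P b).map φ = c.lift f x ≫ (fibreIncl P b).map ψ) : φ = ψ :=
  Functor.Fiber.hom_ext (Functor.IsStronglyCocartesian.ext P f (c.lift f x) (𝟙 b) h)

/-- A morphism of the fibre over `b` from an arrow over the identity of `b`. -/
def vertical {b : B} {x y : P.Fiber b} (χ : (fibreIncl P b).obj x ⟶ (fibreIncl P b).obj y)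
    (h : P.IsHomLift (𝟙 b) χ) : x ⟶ y :=
  ⟨χ, h⟩

/-- The vertical arrow `f_* x ⟶ y` induced by an arrow `x ⟶ y` over `f`. -/
noncomputable def desc {a b : B} (f : a ⟶ b) (x : P.Fiber a) {y : P.Fiber b}
    (φ : (fibreIncl P a).obj x ⟶ (fibreIncl P b).obj y) (hφ : P.IsHomLift f φ) : c.obj f x ⟶ y :=
  vertical (Functor.IsStronglyCocartesian.map P f (c.lift f x) (Category.comp_id f).symm φ)
    inferInstance

theorem lift_desc {a b : B} (f : a ⟶ b) (x : P.Fiber a) {y : P.Fiber b}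
    (φ : (fibreIncl P a).obj x ⟶ (fibreIncl P b).obj y) (hφ : P.IsHomLift f φ) :
    c.lift f x ≫ (fibreIncl P b).map (c.desc f x φ hφ) = φ :=
  Functor.IsStronglyCocartesian.fac P f (c.lift f x) (Category.comp_id f).symm φ

theorem lift_desc_assoc {a b : B} (f : a ⟶ b) (x : P.Fiber a) {y : P.Fiber b}
    (φ : (fibreIncl P a).obj x ⟶ (fibreIncl P b).obj y) (hφ : P.IsHomLift f φ)
    {z : X} (k : (fibreIncl P b).obj y ⟶ z) :
    c.lift f x ≫ (fibreIncl P b).map (c.desc f x φ hφ) ≫ k = φ ≫ k := by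
  rw [← Category.assoc, lift_desc]

theorem isHomLift_map_comp_lift {a b : B} (f : a ⟶ b) {x y : P.Fiber a} (φ : x ⟶ y) :
    P.IsHomLift f ((fibreIncl P a).map φ ≫ c.lift f y) := by
  simpa using (inferInstance : P.IsHomLift (𝟙 a ≫ f) ((fibreIncl P a).map φ ≫ c.lift f y))

/-- The change of base functor `f_*` between the fibres. -/
noncomputable def push {a b : B} (f : a ⟶ b) : P.Fiber a ⥤ P.Fiber b where
  obj x := c.obj f x
  map {x y} φ := c.desc f x ((fibreIncl P a).map φ ≫ c.lift f y) (c.isHomLift_map_comp_lift f φ)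
  map_id x := c.hom_ext f x (by simp [lift_desc])
  map_comp {x y z} φ ψ := c.hom_ext f x (by simp [lift_desc, lift_desc_assoc])

/-- The chosen lifting, with codomain written through the change of base functor. -/
noncomputable def cart {a b : B} (f : a ⟶ b) (x : P.Fiber a) :
    (fibreIncl P a).obj x ⟶ (fibreIncl P b).obj ((c.push f).obj x) :=
  c.lift f x

instance {a b : B} (f : a ⟶ b) (x : P.Fiber a) : P.IsStronglyCocartesian f (c.cart f x) :=
  c.isCocartesian f x

theorem push_hom_ext {a b : B} (f : a ⟶ b) (x : P.Fiber a) {y : P.Fiber b}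
    {φ ψ : (c.push f).obj x ⟶ y}
    (h : c.cart f x ≫ (fibreIncl P b).map φ = c.cart f x ≫ (fibreIncl P b).map ψ) : φ = ψ :=
  c.hom_ext f x h

theorem cart_map {a b : B} (f : a ⟶ b) {x y : P.Fiber a} (φ : x ⟶ y) :
    c.cart f x ≫ (fibreIncl P b).map ((c.push f).map φ) = (fibreIncl P a).map φ ≫ c.cart f y :=
  c.lift_desc _ _ _ (c.isHomLift_map_comp_lift f φ)

theorem cart_map_assoc {a b : B} (f : a ⟶ b) {x y : P.Fiber a} (φ : x ⟶ y)
    {z : X} (k : (fibreIncl P b).obj ((c.push f).obj y) ⟶ z) :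
    c.cart f x ≫ (fibreIncl P b).map ((c.push f).map φ) ≫ k = (fibreIncl P a).map φ ≫ c.cart f y ≫ k := by
  rw [← Category.assoc, cart_map, Category.assoc]

/-- The chosen liftings of `f` are natural with respect to vertical arrows. -/
noncomputable def liftNat {a b : B} (f : a ⟶ b) :
    fibreIncl P a ⟶ c.push f ⋙ fibreIncl P b where
  app x := c.cart f x
  naturality _ _ φ := (c.cart_map f φ).symm

/-- The codomain of any cocartesian lifting of `f` at `x` is canonically isomorphic to `f_* x`. -/
noncomputable def isoOfCocartesian {a b : B} (f : a ⟶ b) (x : P.Fiber a) (y : P.Fiber b)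
    (φ : (fibreIncl P a).obj x ⟶ (fibreIncl P b).obj y) (hφ : P.IsStronglyCocartesian f φ) :
    (c.push f).obj x ≅ y :=
  have h : φ ≫ Functor.IsStronglyCocartesian.map P f φ (Category.comp_id f).symm (c.cart f x) =
      c.cart f x := Functor.IsStronglyCocartesian.fac P f φ _ _
  have h' : c.cart f x ≫ Functor.IsStronglyCocartesian.map P f (c.cart f x)
      (Category.comp_id f).symm φ = φ := Functor.IsStronglyCocartesian.fac P f _ _ _
  { hom := vertical
      (Functor.IsStronglyCocartesian.map P f (c.cart f x) (Category.comp_id f).symm φ)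
      inferInstance
    inv := vertical
      (Functor.IsStronglyCocartesian.map P f φ (Category.comp_id f).symm (c.cart f x))
      inferInstance
    hom_inv_id := c.push_hom_ext f x (by
      rw [Functor.map_comp, CategoryTheory.Functor.map_id]
      exact ((Category.assoc _ _ _).symm.trans ((congrArg (· ≫ _) h').trans h)).trans
        (Category.comp_id _).symm)
    inv_hom_id := Functor.Fiber.hom_ext (Functor.IsStronglyCocartesian.ext P f φ (𝟙 b) (by
      rw [Functor.map_comp, CategoryTheory.Functor.map_id]
      exact ((Category.assoc _ _ _).symm.trans ((congrArg (· ≫ _) h).trans h')).trans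
        (Category.comp_id _).symm)) }

theorem cart_isoOfCocartesian {a b : B} (f : a ⟶ b) (x : P.Fiber a) (y : P.Fiber b)
    (φ : (fibreIncl P a).obj x ⟶ (fibreIncl P b).obj y) (hφ : P.IsStronglyCocartesian f φ) :
    c.cart f x ≫ (fibreIncl P b).map (c.isoOfCocartesian f x y φ hφ).hom = φ :=
  Functor.IsStronglyCocartesian.fac P f (c.cart f x) (Category.comp_id f).symm φ

theorem cart_isoOfCocartesian_assoc {a b : B} (f : a ⟶ b) (x : P.Fiber a) (y : P.Fiber b)
    (φ : (fibreIncl P a).obj x ⟶ (fibreIncl P b).obj y) (hφ : P.IsStronglyCocartesian f φ)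
    {z : X} (k : (fibreIncl P b).obj y ⟶ z) :
    c.cart f x ≫ (fibreIncl P b).map (c.isoOfCocartesian f x y φ hφ).hom ≫ k = φ ≫ k := by
  rw [← Category.assoc, cart_isoOfCocartesian]

theorem isStronglyCocartesian_id (a : B) (x : P.Fiber a) :
    P.IsStronglyCocartesian (𝟙 a) (𝟙 ((fibreIncl P a).obj x)) :=
  have : P.IsHomLift (𝟙 a) (𝟙 ((fibreIncl P a).obj x)) := IsHomLift.id x.2
  inferInstance

/-- The canonical isomorphism between `(𝟙 a)_*` and the identity functor. -/
noncomputable def pushId (a : B) : c.push (𝟙 a) ≅ 𝟭 (P.Fiber a) :=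
  NatIso.ofComponents
    (fun x => c.isoOfCocartesian (𝟙 a) x ((𝟭 (P.Fiber a)).obj x) (𝟙 _)
      (isStronglyCocartesian_id a x))
    (fun {x y} φ => c.push_hom_ext _ _ (by
      rw [Functor.map_comp, Functor.map_comp]
      rw [cart_map_assoc, cart_isoOfCocartesian, cart_isoOfCocartesian_assoc]
      exact (Category.comp_id _).trans (Category.id_comp _).symm))

theorem cart_pushId (a : B) (x : P.Fiber a) :
    c.cart (𝟙 a) x ≫ (fibreIncl P a).map ((c.pushId a).hom.app x) = 𝟙 _ :=
  c.cart_isoOfCocartesian (𝟙 a) x x (𝟙 _) (isStronglyCocartesian_id a x)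

theorem cart_pushId_assoc (a : B) (x : P.Fiber a)
    {z : X} (k : (fibreIncl P a).obj x ⟶ z) :
    c.cart (𝟙 a) x ≫ (fibreIncl P a).map ((c.pushId a).hom.app x) ≫ k = k := by
  exact (Category.assoc _ _ _).symm.trans ((congrArg (· ≫ k) (c.cart_pushId a x)).trans
    (Category.id_comp k))

theorem isStronglyCocartesian_comp {a b d : B} (f : a ⟶ b) (g : b ⟶ d) (x : P.Fiber a) :
    P.IsStronglyCocartesian (f ≫ g) (c.cart f x ≫ c.cart g ((c.push f).obj x)) :=
  inferInstance

/-- The canonical isomorphism between `(f ≫ g)_*` and `f_*` followed by `g_*`. -/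
noncomputable def pushComp {a b d : B} (f : a ⟶ b) (g : b ⟶ d) :
    c.push (f ≫ g) ≅ c.push f ⋙ c.push g :=
  NatIso.ofComponents
    (fun x => c.isoOfCocartesian (f ≫ g) x ((c.push f ⋙ c.push g).obj x)
      (c.cart f x ≫ c.cart g ((c.push f).obj x)) (c.isStronglyCocartesian_comp f g x))
    (fun {x y} φ => c.push_hom_ext _ _ (by
      rw [Functor.map_comp, Functor.map_comp]
      rw [cart_map_assoc, cart_isoOfCocartesian, cart_isoOfCocartesian_assoc]
      refine ((c.cart_map_assoc f φ _).symm.trans ?_).trans (Category.assoc _ _ _).symm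
      exact congrArg (_ ≫ ·) (c.cart_map g ((c.push f).map φ)).symm))

theorem cart_pushComp {a b d : B} (f : a ⟶ b) (g : b ⟶ d) (x : P.Fiber a) :
    c.cart (f ≫ g) x ≫ (fibreIncl P d).map ((c.pushComp f g).hom.app x) =
      c.cart f x ≫ c.cart g ((c.push f).obj x) :=
  c.cart_isoOfCocartesian (f ≫ g) x _ _ (c.isStronglyCocartesian_comp f g x)

theorem cart_pushComp_assoc {a b d : B} (f : a ⟶ b) (g : b ⟶ d) (x : P.Fiber a)
    {z : X} (k : (fibreIncl P d).obj ((c.push g).obj ((c.push f).obj x)) ⟶ z) :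
    c.cart (f ≫ g) x ≫ (fibreIncl P d).map ((c.pushComp f g).hom.app x) ≫ k = c.cart f x ≫ c.cart g ((c.push f).obj x) ≫ k := by
  exact (Category.assoc _ _ _).symm.trans ((congrArg (· ≫ k) (c.cart_pushComp f g x)).trans
    (Category.assoc _ _ _))

theorem cart_pushComp_inv {a b d : B} (f : a ⟶ b) (g : b ⟶ d) (x : P.Fiber a) :
    c.cart f x ≫ c.cart g ((c.push f).obj x) ≫
      (fibreIncl P d).map ((c.pushComp f g).inv.app x) = c.cart (f ≫ g) x := by
  have h := c.cart_pushComp_assoc f g x ((fibreIncl P d).map ((c.pushComp f g).inv.app x))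
  rw [← h, ← Functor.map_comp, Iso.hom_inv_id_app, CategoryTheory.Functor.map_id,
    Category.comp_id]

theorem cart_eqToHom {a b : B} {f g : a ⟶ b} (h : f = g) (h' : c.push f = c.push g)
    (x : P.Fiber a) :
    c.cart f x ≫ (fibreIncl P b).map ((eqToHom h').app x) = c.cart g x := by
  subst h
  simp

theorem push_associator {a₀ a₁ a₂ a₃ : B} (f : a₀ ⟶ a₁) (g : a₁ ⟶ a₂) (h : a₂ ⟶ a₃)
    (e : c.push ((f ≫ g) ≫ h) = c.push (f ≫ g ≫ h)) (x : P.Fiber a₀) :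
    (c.pushComp (f ≫ g) h).hom.app x ≫ (c.push h).map ((c.pushComp f g).hom.app x) ≫ 𝟙 _ ≫
      (c.pushComp g h).inv.app ((c.push f).obj x) ≫ (c.pushComp f (g ≫ h)).inv.app x =
        (eqToHom e).app x := by
  refine c.push_hom_ext ((f ≫ g) ≫ h) x
    (Eq.trans ?_ (c.cart_eqToHom (Category.assoc f g h) e x).symm)
  rw [Functor.map_comp, Functor.map_comp, cart_pushComp_assoc, cart_map_assoc,
    cart_pushComp_assoc, Category.id_comp, Functor.map_comp]
  have h₁ := c.cart_pushComp_inv g h ((c.push f).obj x)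
  have h₂ := c.cart_pushComp_inv f (g ≫ h) x
  rw [← h₂, ← h₁]
  simp only [Category.assoc]
  rfl

theorem push_leftUnitor {a b : B} (f : a ⟶ b) (e : c.push (𝟙 a ≫ f) = c.push f) (x : P.Fiber a) :
    (c.pushComp (𝟙 a) f).hom.app x ≫ (c.push f).map ((c.pushId a).hom.app x) ≫ 𝟙 _ =
      (eqToHom e).app x := by
  refine c.push_hom_ext (𝟙 a ≫ f) x
    (Eq.trans ?_ (c.cart_eqToHom (Category.id_comp f) e x).symm)
  rw [Functor.map_comp, cart_pushComp_assoc, Category.comp_id, cart_map, cart_pushId_assoc]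
  rfl

theorem push_rightUnitor {a b : B} (f : a ⟶ b) (e : c.push (f ≫ 𝟙 b) = c.push f)
    (x : P.Fiber a) :
    (c.pushComp f (𝟙 b)).hom.app x ≫ (c.pushId b).hom.app ((c.push f).obj x) ≫ 𝟙 _ =
      (eqToHom e).app x := by
  refine c.push_hom_ext (f ≫ 𝟙 b) x
    (Eq.trans ?_ (c.cart_eqToHom (Category.comp_id f) e x).symm)
  rw [Functor.map_comp, cart_pushComp_assoc, Category.comp_id, cart_pushId]
  exact Category.comp_id _

/-- The pseudofunctor associated with a cloven opfibration: it sends `a` to the fibre over `a` and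
`f` to the change of base functor `f_*`. -/
noncomputable def pseudofunctor : Pseudofunctor (LocallyDiscrete B) Cat.{v₂, u₂} :=
  pseudofunctorOfIsLocallyDiscrete
    (fun a => Cat.of (P.Fiber a.as))
    (fun f => (c.push f.as).toCatHom)
    (fun a => Cat.Hom.isoMk (c.pushId a.as))
    (fun f g => Cat.Hom.isoMk (c.pushComp f.as g.as))
    (fun f g h => Cat.Hom₂.ext (NatTrans.ext (funext fun x => by
      rw [Cat.Hom₂.eqToHom_toNatTrans]
      exact c.push_associator f.as g.as h.as _ x)))
    (fun f => Cat.Hom₂.ext (NatTrans.ext (funext fun x => by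
      rw [Cat.Hom₂.eqToHom_toNatTrans]
      exact c.push_leftUnitor f.as _ x)))
    (fun f => Cat.Hom₂.ext (NatTrans.ext (funext fun x => by
      rw [Cat.Hom₂.eqToHom_toNatTrans]
      exact c.push_rightUnitor f.as _ x)))

/-- The pseudofunctor associated with the cleavage factors (strictly) through the forgetful
2-functor from symmetric 2-groups to categories. -/
def FactorsThroughSCG : Prop :=
  ∃ G : Pseudofunctor (LocallyDiscrete B) SCG.{v₂, u₂}, G.comp SCG.forget = c.pseudofunctor

/-- Given symmetric monoidal structures on the fibres and strong symmetric monoidal structures on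
the change of base functors, the property that these make the associated pseudofunctor take values
in symmetric 2-groups. -/
structure IsSCGLift [∀ a, MonoidalCategory (P.Fiber a)] [∀ a, SymmetricCategory (P.Fiber a)]
    [∀ {a b : B} (f : a ⟶ b), (c.push f).Braided] : Prop where
  isGroupoid (a : B) : IsGroupoid (P.Fiber a)
  exists_inverse (a : B) (x : P.Fiber a) :
    ∃ y : P.Fiber a, Nonempty (x ⊗ y ≅ 𝟙_ (P.Fiber a)) ∧ Nonempty (y ⊗ x ≅ 𝟙_ (P.Fiber a))
  pushId_isMonoidal (a : B) : NatTrans.IsMonoidal (c.pushId a).hom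
  pushComp_isMonoidal {a b d : B} (f : a ⟶ b) (g : b ⟶ d) :
    NatTrans.IsMonoidal (c.pushComp f g).hom

namespace IsSCGLift

variable {c} [∀ a, MonoidalCategory (P.Fiber a)] [∀ a, SymmetricCategory (P.Fiber a)]
    [∀ {a b : B} (f : a ⟶ b), (c.push f).Braided]

/-- The pseudofunctor with values in symmetric 2-groups given by symmetric monoidal structures on
the fibres and on the change of base functors. -/
noncomputable def toSCG (h : c.IsSCGLift) : Pseudofunctor (LocallyDiscrete B) SCG.{v₂, u₂} :=
  pseudofunctorOfIsLocallyDiscrete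
    (fun a => SCG.mk (P.Fiber a.as) (h.isGroupoid a.as) (h.exists_inverse a.as))
    (fun f => SCG.Hom.mk (c.push f.as))
    (fun a => SCG.isoMk (c.pushId a.as) (h.pushId_isMonoidal a.as))
    (fun f g => SCG.isoMk (c.pushComp f.as g.as) (h.pushComp_isMonoidal f.as g.as))
    (fun f g h => SCG.hom₂_ext fun x => by
      rw [SCG.eqToHom_natTrans]
      exact c.push_associator f.as g.as h.as _ x)
    (fun f => SCG.hom₂_ext fun x => by
      rw [SCG.eqToHom_natTrans]
      exact c.push_leftUnitor f.as _ x)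
    (fun f => SCG.hom₂_ext fun x => by
      rw [SCG.eqToHom_natTrans]
      exact c.push_rightUnitor f.as _ x)

theorem toSCG_comp_forget (h : c.IsSCGLift) : h.toSCG.comp SCG.forget = c.pseudofunctor := by
  refine pseudofunctor_ext_of_toPrelaxFunctorStruct_eq ?_ ?_ ?_
  · refine congrArg (PrelaxFunctorStruct.mk c.pseudofunctor.toPrefunctor) ?_
    funext a b f g η
    obtain rfl := LocallyDiscrete.eq_of_hom η
    exact ((h.toSCG.comp SCG.forget).map₂_id f).trans (c.pseudofunctor.map₂_id f).symm
  · refine heq_of_eq (funext fun a => Iso.ext ?_)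
    exact Category.comp_id _
  · refine heq_of_eq ?_
    funext a b d f g
    exact Iso.ext (Category.comp_id _)

theorem factorsThroughSCG (h : c.IsSCGLift) : c.FactorsThroughSCG :=
  ⟨h.toSCG, h.toSCG_comp_forget⟩

end IsSCGLift

end OpCleavage

/-! ### Cartesian monoidal opfibrations -/

/-- For chosen finite products on `X` and `B`, the functor `P` strictly preserves them and products
of cocartesian arrows are cocartesian. Together with a cleavage of `P`, this says that `P` is a
cartesian monoidal opfibration. -/
class IsCartesianMonoidal [CartesianMonoidalCategory B] [CartesianMonoidalCategory X]
    (P : X ⥤ B) : Prop where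
  obj_unit : P.obj (𝟙_ X) = 𝟙_ B
  isHomLift_fst (x y : X) : P.IsHomLift (fst (P.obj x) (P.obj y)) (fst x y)
  isHomLift_snd (x y : X) : P.IsHomLift (snd (P.obj x) (P.obj y)) (snd x y)
  tensorHom_cocartesian {x x' y y' : X} (φ : x ⟶ x') (ψ : y ⟶ y') :
    P.IsStronglyCocartesian (P.map φ) φ → P.IsStronglyCocartesian (P.map ψ) ψ →
      P.IsStronglyCocartesian (P.map φ ⊗ₘ P.map ψ) (φ ⊗ₘ ψ)

section

variable [CartesianMonoidalCategory B] [CartesianMonoidalCategory X] (P : X ⥤ B)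
  [IsCartesianMonoidal P]

/-- The terminal object of `X`, in the fibre over the terminal object of `B`. -/
def fibreUnit : P.Fiber (𝟙_ B) := Functor.Fiber.mk (IsCartesianMonoidal.obj_unit (P := P))

theorem obj_tensor (x y : X) : P.obj (x ⊗ y) = P.obj x ⊗ P.obj y :=
  have := IsCartesianMonoidal.isHomLift_fst (P := P) x y
  IsHomLift.domain_eq P (fst (P.obj x) (P.obj y)) (fst x y)

variable {P}

/-- The product in `X` of an object over `a` and an object over `b`, in the fibre over the product
of `a` and `b`. -/
def fibreProd {a b : B} (x : P.Fiber a) (y : P.Fiber b) : P.Fiber (a ⊗ b) :=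
  Functor.Fiber.mk (a := (fibreIncl P a).obj x ⊗ (fibreIncl P b).obj y) (by
    exact (obj_tensor P _ _).trans (congrArg₂ (· ⊗ ·) x.2 y.2))

end

namespace OpCleavage

/-- Symmetric monoidal structures on the fibres and on the change of base functors are *canonical*
if they are those obtained from the products of `X` and the commutative monoid structures on the
objects of the additive category `B`: the unit of the fibre over `a` is `e_*` of the terminal object
of `X`, where `e : 𝟙_ B ⟶ a` is the zero of `a`, the tensor product of `x` and `y` is `m_*` of their
product in `X`, where `m : a ⊗ a ⟶ a` is the addition of `a`, and the constraint isomorphisms are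
the ones induced by those of the products in `X`, i.e. the chosen cocartesian liftings of `e` and
`m` make the inclusion of the fibre into `X` lax symmetric monoidal, and the chosen liftings of each
arrow of `B` form a monoidal transformation. -/
structure IsCanonical [Preadditive B] [CartesianMonoidalCategory B] [CartesianMonoidalCategory X]
    {P : X ⥤ B} [IsCartesianMonoidal P] (c : OpCleavage P)
    [∀ a, MonoidalCategory (P.Fiber a)] [∀ a, SymmetricCategory (P.Fiber a)]
    [∀ {a b : B} (f : a ⟶ b), (c.push f).Braided]
    [∀ a, (fibreIncl P a).LaxMonoidal] : Prop where
  unit_eq (a : B) :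
    (⟨𝟙_ (P.Fiber a), Functor.LaxMonoidal.ε (fibreIncl P a)⟩ :
        Σ z : P.Fiber a, (𝟙_ X ⟶ (fibreIncl P a).obj z)) =
      ⟨c.obj (0 : 𝟙_ B ⟶ a) (fibreUnit P), c.lift (0 : 𝟙_ B ⟶ a) (fibreUnit P)⟩
  tensor_eq (a : B) (x y : P.Fiber a) :
    (⟨x ⊗ y, Functor.LaxMonoidal.μ (fibreIncl P a) x y⟩ :
        Σ z : P.Fiber a, ((fibreIncl P a).obj x ⊗ (fibreIncl P a).obj y ⟶
          (fibreIncl P a).obj z)) =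
      ⟨c.obj (fst a a + snd a a) (fibreProd x y), c.lift (fst a a + snd a a) (fibreProd x y)⟩
  braiding (a : B) (x y : P.Fiber a) :
    Functor.LaxMonoidal.μ (fibreIncl P a) x y ≫ (fibreIncl P a).map (β_ x y).hom =
      CartesianMonoidalCategory.lift (snd _ _) (fst _ _) ≫ Functor.LaxMonoidal.μ (fibreIncl P a) y x
  liftNat_isMonoidal {a b : B} (f : a ⟶ b) : NatTrans.IsMonoidal (c.liftNat f)

/-- The pseudofunctor associated with the cleavage factors through symmetric 2-groups, by means of
the canonical symmetric monoidal structures on the fibres. -/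
def FactorsCanonicallyThroughSCG [Preadditive B] [CartesianMonoidalCategory B]
    [CartesianMonoidalCategory X] {P : X ⥤ B} [IsCartesianMonoidal P] (c : OpCleavage P) : Prop :=
  ∃ (_ : ∀ a, MonoidalCategory (P.Fiber a)) (_ : ∀ a, SymmetricCategory (P.Fiber a))
    (_ : ∀ {a b : B} (f : a ⟶ b), (c.push f).Braided) (_ : ∀ a, (fibreIncl P a).LaxMonoidal)
    (h : c.IsSCGLift), h.toSCG.comp SCG.forget = c.pseudofunctor ∧ c.IsCanonical

end OpCleavage

end

/-!
If the pseudofunctor factors through symmetric 2-groups, each fibre is the underlying category of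
one, hence a groupoid.

Conversely, suppose the fibres are groupoids. Any arrow `φ : x ⟶ y` of `X` over `f` is the chosen
lifting `x ⟶ f_* x` followed by a vertical arrow, which is now invertible; so *every* arrow of `X` is
cocartesian (`OpCleavage.isStronglyCocartesian_of_isHomLift`). This has two consequences for arrows
`φ : w ⟶ y` and `ψ : w ⟶ z` of `X` with `y` and `z` in the fibre over `a`:

* if `φ` and `ψ` lie over the same arrow of `B`, then `ψ` factors through `φ` by a vertical
  isomorphism (`OpCleavage.factor`);
* vertical arrows out of `y` are equal as soon as their composites with `φ` are
  (`OpCleavage.separatesByPrecomp`).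

The first supplies all structure maps. For instance, the associator of the fibre over `a` exists
because the two arrows from `(x × y) × z` to `(x ⊗ y) ⊗ z` and to `x ⊗ (y ⊗ z)` assembled from the
chosen liftings of the addition lie over the same arrow, namely the threefold addition; likewise the
unit constraints, the symmetry and the comparison maps of `f_*` come from the unit law, from
commutativity and from `f` being additive. The second supplies all coherence axioms: along a
functor that separates in this sense, the axioms of a monoidal category, a symmetry, a lax monoidal
functor and a monoidal transformation are inherited from those of the target
(`Functor.monoidalCategoryOfSeparates`, `Functor.symmetricCategoryOfSeparates`,
`Functor.laxMonoidalOfSeparates`, `Functor.isMonoidal_of_separates`).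

Finally `(-1)_* x` is inverse to `x` (`OpCleavage.exists_tensor_inverse`): the composite of the
pairing of the identity with the lifting of `-1`, from `x` to `x × (-1)_* x`, and the lifting of the
addition lies over `1 + (-1) = 0`, as does the composite of `x ⟶ I` with `I ⟶ e_* I`.
-/

/-! ### Functors separating by precomposition -/

namespace CategoryTheory.Functor

section Separates

variable {C D X : Type*} [Category* C] [Category* D] [Category* X]

/-- A functor `i : D ⥤ X` *separates by precomposition* if a morphism `α` of `D` is determined by
the composite of `i.map α` with any single arrow of `X` into its domain: every arrow of `X` into an
object `i.obj y` is epic relative to the image of `i`. -/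
def SeparatesByPrecomp (i : D ⥤ X) : Prop :=
  ∀ ⦃w : X⦄ ⦃y z : D⦄ (φ : w ⟶ i.obj y) (α β : y ⟶ z), φ ≫ i.map α = φ ≫ i.map β → α = β

variable [MonoidalCategory X]

section Struct

variable [MonoidalCategoryStruct D] {i : D ⥤ X} (hi : i.SeparatesByPrecomp)
  (ε : 𝟙_ X ⟶ i.obj (𝟙_ D)) (μ : ∀ x y : D, i.obj x ⊗ i.obj y ⟶ i.obj (x ⊗ y))
  (whiskerLeft_eq : ∀ (x : D) {y z : D} (f : y ⟶ z), x ◁ f = 𝟙 x ⊗ₘ f)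
  (whiskerRight_eq : ∀ {x y : D} (f : x ⟶ y) (z : D), f ▷ z = f ⊗ₘ 𝟙 z)
  (μ_natural : ∀ {x x' y y' : D} (f : x ⟶ x') (g : y ⟶ y'),
    μ x y ≫ i.map (f ⊗ₘ g) = (i.map f ⊗ₘ i.map g) ≫ μ x' y')
  (associativity : ∀ x y z : D, μ x y ▷ i.obj z ≫ μ (x ⊗ y) z ≫ i.map (α_ x y z).hom =
    (α_ (i.obj x) (i.obj y) (i.obj z)).hom ≫ i.obj x ◁ μ y z ≫ μ x (y ⊗ z))
  (left_unitality : ∀ x : D,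
    ε ▷ i.obj x ≫ μ (𝟙_ D) x ≫ i.map (λ_ x).hom = (λ_ (i.obj x)).hom)
  (right_unitality : ∀ x : D,
    i.obj x ◁ ε ≫ μ x (𝟙_ D) ≫ i.map (ρ_ x).hom = (ρ_ (i.obj x)).hom)

include hi whiskerLeft_eq whiskerRight_eq μ_natural associativity left_unitality right_unitality in
/-- The coherence axioms of a monoidal category can be checked after a separating functor along
which the structure is lax monoidal: precomposing with iterated tensorators `μ` and units `ε` turns
each axiom into the same axiom in `X`. -/
abbrev monoidalCategoryOfSeparates : MonoidalCategory D :=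
  .ofTensorHom
    (id_tensorHom_id := fun x y => hi (μ x y) _ _ (by simp [μ_natural]))
    (id_tensorHom := fun x _ _ f => (whiskerLeft_eq x f).symm)
    (tensorHom_id := fun f z => (whiskerRight_eq f z).symm)
    (tensorHom_comp_tensorHom := fun f₁ f₂ g₁ g₂ => hi (μ _ _) _ _ (by
      simp [μ_natural, reassoc_of% @μ_natural]))
    (associator_naturality := fun {x₁ x₂ x₃ y₁ y₂ y₃} f₁ f₂ f₃ =>
      hi (μ x₁ x₂ ▷ i.obj x₃ ≫ μ _ _) _ _ (by
        simp only [Category.assoc, Functor.map_comp, reassoc_of% associativity,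
          reassoc_of% @μ_natural, μ_natural]
        rw [← tensorHom_id, tensorHom_comp_tensorHom_assoc, Category.id_comp, μ_natural,
          ← Category.comp_id (i.map f₃), ← tensorHom_comp_tensorHom_assoc, tensorHom_id,
          associativity, associator_naturality_assoc, ← id_tensorHom, ← id_tensorHom,
          tensorHom_comp_tensorHom_assoc, tensorHom_comp_tensorHom_assoc, μ_natural,
          Category.id_comp, Category.comp_id]))
    (leftUnitor_naturality := fun {x y} f => hi (ε ▷ i.obj x ≫ μ _ _) _ _ (by
        simp only [Category.assoc, Functor.map_comp, reassoc_of% left_unitality,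
          reassoc_of% @μ_natural]
        rw [← leftUnitor_naturality, ← left_unitality, ← id_tensorHom, ← tensorHom_id,
          ← tensorHom_id, tensorHom_comp_tensorHom_assoc, tensorHom_comp_tensorHom_assoc]
        simp))
    (rightUnitor_naturality := fun {x y} f => hi (i.obj x ◁ ε ≫ μ _ _) _ _ (by
        simp only [Category.assoc, Functor.map_comp, reassoc_of% right_unitality,
          reassoc_of% @μ_natural]
        rw [← rightUnitor_naturality, ← right_unitality, ← id_tensorHom, ← tensorHom_id,
          ← id_tensorHom, tensorHom_comp_tensorHom_assoc, tensorHom_comp_tensorHom_assoc]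
        simp))
    (pentagon := fun w x y z =>
      hi (μ w x ▷ i.obj y ▷ i.obj z ≫ μ (w ⊗ x) y ▷ i.obj z ≫ μ _ _) _ _ (by
        have h₁ : μ w x ▷ i.obj y ▷ i.obj z ≫ μ (w ⊗ x) y ▷ i.obj z ≫
            i.map (α_ w x y).hom ▷ i.obj z = (α_ _ _ _).hom ▷ i.obj z ≫
              (i.obj w ◁ μ x y) ▷ i.obj z ≫ μ w (x ⊗ y) ▷ i.obj z := by
          simp only [← comp_whiskerRight, associativity]
        have h₂ : i.obj w ◁ μ x y ▷ i.obj z ≫ i.obj w ◁ μ (x ⊗ y) z ≫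
            i.obj w ◁ i.map (α_ x y z).hom = i.obj w ◁ (α_ _ _ _).hom ≫
              i.obj w ◁ i.obj x ◁ μ y z ≫ i.obj w ◁ μ x (y ⊗ z) := by
          simp only [← MonoidalCategory.whiskerLeft_comp, associativity]
        simp only [Category.assoc, Functor.map_comp, reassoc_of% @μ_natural,
          Functor.map_id, tensorHom_id, reassoc_of% associativity]
        rw [reassoc_of% h₁, reassoc_of% associativity, μ_natural, Functor.map_id, id_tensorHom,
          associator_naturality_middle_assoc, reassoc_of% h₂, pentagon_assoc,
          associator_naturality_left_assoc, ← whisker_exchange_assoc, associativity,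
          associator_naturality_right_assoc]))
    (triangle := fun x y => hi ((i.obj x ◁ ε) ▷ i.obj y ≫ μ x (𝟙_ D) ▷ i.obj y ≫ μ _ _) _ _ (by
        have h₁ : (i.obj x ◁ ε) ▷ i.obj y ≫ μ x (𝟙_ D) ▷ i.obj y ≫
            i.map (ρ_ x).hom ▷ i.obj y = (ρ_ _).hom ▷ i.obj y := by
          simp only [← comp_whiskerRight, right_unitality]
        have h₂ : i.obj x ◁ ε ▷ i.obj y ≫ i.obj x ◁ μ (𝟙_ D) y ≫
            i.obj x ◁ i.map (λ_ y).hom = i.obj x ◁ (λ_ _).hom := by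
          simp only [← MonoidalCategory.whiskerLeft_comp, left_unitality]
        simp only [Category.assoc, Functor.map_comp, μ_natural,
          Functor.map_id, tensorHom_id, id_tensorHom, reassoc_of% associativity]
        rw [reassoc_of% h₁, associator_naturality_middle_assoc, reassoc_of% h₂,
          triangle_assoc]))

end Struct

section Symmetric

variable [MonoidalCategory D] {i : D ⥤ X} [i.LaxMonoidal] [SymmetricCategory X]

open Functor.LaxMonoidal

/-- The axioms of a symmetry can be checked after a separating lax monoidal functor. -/
abbrev symmetricCategoryOfSeparates (hi : i.SeparatesByPrecomp)
    (b : ∀ x y : D, x ⊗ y ≅ y ⊗ x)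
    (hb : ∀ x y, μ i x y ≫ i.map (b x y).hom = (β_ (i.obj x) (i.obj y)).hom ≫ μ i y x) :
    SymmetricCategory D where
  braiding := b
  braiding_naturality_right x {y z} f := hi (μ i x y) _ _ (by
    simp [← μ_natural_right_assoc, hb, reassoc_of% hb, ← μ_natural_left])
  braiding_naturality_left {x y} f z := hi (μ i x z) _ _ (by
    simp [← μ_natural_left_assoc, hb, reassoc_of% hb, ← μ_natural_right])
  hexagon_forward x y z := hi (μ i x y ▷ i.obj z ≫ μ i _ _) _ _ (by
    have h₁ : μ i x y ▷ i.obj z ≫ i.map (b x y).hom ▷ i.obj z =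
        (β_ _ _).hom ▷ i.obj z ≫ μ i y x ▷ i.obj z := by
      simp only [← comp_whiskerRight, hb]
    have h₂ : i.obj y ◁ μ i x z ≫ i.obj y ◁ i.map (b x z).hom =
        i.obj y ◁ (β_ _ _).hom ≫ i.obj y ◁ μ i z x := by
      simp only [← MonoidalCategory.whiskerLeft_comp, hb]
    simp only [Category.assoc, Functor.map_comp, associativity_assoc, reassoc_of% hb,
      ← μ_natural_left_assoc]
    rw [BraidedCategory.braiding_naturality_right_assoc, associativity, reassoc_of% h₁,
      associativity_assoc, ← μ_natural_right, reassoc_of% h₂,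
      BraidedCategory.hexagon_forward_assoc])
  hexagon_reverse x y z := hi (i.obj x ◁ μ i y z ≫ μ i _ _) _ _ (by
    have h₁ : μ i x z ▷ i.obj y ≫ i.map (b x z).hom ▷ i.obj y =
        (β_ _ _).hom ▷ i.obj y ≫ μ i z x ▷ i.obj y := by
      simp only [← comp_whiskerRight, hb]
    have h₂ : i.obj x ◁ μ i y z ≫ i.obj x ◁ i.map (b y z).hom =
        i.obj x ◁ (β_ _ _).hom ≫ i.obj x ◁ μ i z y := by
      simp only [← MonoidalCategory.whiskerLeft_comp, hb]
    simp only [Category.assoc, Functor.map_comp, associativity_inv_assoc, reassoc_of% hb,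
      ← μ_natural_right_assoc]
    rw [BraidedCategory.braiding_naturality_left_assoc, associativity_inv, reassoc_of% h₂,
      associativity_inv_assoc, ← μ_natural_left, reassoc_of% h₁,
      BraidedCategory.hexagon_reverse_assoc])
  symmetry x y := hi (μ i x y) _ _ (by simp [hb, reassoc_of% hb])

end Symmetric

section Transformation

variable [MonoidalCategory C] [MonoidalCategory D] {i : C ⥤ X} {j : D ⥤ X}
  [i.LaxMonoidal] [j.LaxMonoidal]

open Functor.LaxMonoidal

/-- The axioms of a lax monoidal functor `F` can be checked after a separating functor `j`, if there
is a transformation `τ` to `F ⋙ j` from a lax monoidal functor compatible with the structure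
maps. -/
abbrev laxMonoidalOfSeparates (hj : j.SeparatesByPrecomp) {F : C ⥤ D}
    (τ : ∀ x, i.obj x ⟶ j.obj (F.obj x))
    (hτ : ∀ {x y : C} (f : x ⟶ y), i.map f ≫ τ y = τ x ≫ j.map (F.map f))
    (εF : 𝟙_ D ⟶ F.obj (𝟙_ C)) (μF : ∀ x y : C, F.obj x ⊗ F.obj y ⟶ F.obj (x ⊗ y))
    (hε : ε j ≫ j.map εF = ε i ≫ τ (𝟙_ C))
    (hμ : ∀ x y, (τ x ⊗ₘ τ y) ≫ μ j (F.obj x) (F.obj y) ≫ j.map (μF x y) =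
      μ i x y ≫ τ (x ⊗ y)) : F.LaxMonoidal where
  ε := εF
  μ := μF
  μ_natural_left {x y} f z := hj ((τ x ⊗ₘ τ z) ≫ μ j (F.obj x) (F.obj z)) _ _ (by
    have h := hτ f
    have h' := hτ (f ▷ z)
    simp only [Category.assoc, Functor.map_comp, reassoc_of% hμ, ← μ_natural_left_assoc]
    rw [← h', ← μ_natural_left_assoc, ← hμ, ← tensorHom_id, ← tensorHom_id,
      tensorHom_comp_tensorHom_assoc, tensorHom_comp_tensorHom_assoc, h]
    simp)
  μ_natural_right {x y} z f := hj ((τ z ⊗ₘ τ x) ≫ μ j (F.obj z) (F.obj x)) _ _ (by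
    have h := hτ f
    have h' := hτ (z ◁ f)
    simp only [Category.assoc, Functor.map_comp, reassoc_of% hμ, ← μ_natural_right_assoc]
    rw [← h', ← μ_natural_right_assoc, ← hμ, ← id_tensorHom, ← id_tensorHom,
      tensorHom_comp_tensorHom_assoc, tensorHom_comp_tensorHom_assoc, h]
    simp)
  associativity x y z :=
    hj (((τ x ⊗ₘ τ y) ⊗ₘ τ z) ≫ μ j _ _ ▷ j.obj (F.obj z) ≫ μ j _ _) _ _ (by
      have h := hτ (α_ x y z).hom
      have h₁ : ((τ x ⊗ₘ τ y) ⊗ₘ τ z) ≫ μ j _ _ ▷ j.obj (F.obj z) ≫ j.map (μF x y) ▷ _ =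
          μ i x y ▷ _ ≫ (τ (x ⊗ y) ⊗ₘ τ z) := by
        simp only [← tensorHom_id, tensorHom_comp_tensorHom, hμ, Category.id_comp,
          Category.comp_id]
      have h₂ : (τ x ⊗ₘ (τ y ⊗ₘ τ z)) ≫ _ ◁ μ j _ _ ≫ _ ◁ j.map (μF y z) =
          _ ◁ μ i y z ≫ (τ x ⊗ₘ τ (y ⊗ z)) := by
        simp only [← id_tensorHom, tensorHom_comp_tensorHom, hμ, Category.id_comp,
          Category.comp_id]
      simp only [Category.assoc, Functor.map_comp, ← μ_natural_left_assoc, associativity_assoc,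
        ← μ_natural_right_assoc]
      rw [reassoc_of% h₁, reassoc_of% hμ, ← h, associativity_assoc,
        associator_naturality_assoc, reassoc_of% h₂, hμ])
  left_unitality x := hj (ε j ▷ _ ≫ (j.obj (𝟙_ D) ◁ τ x) ≫ μ j _ _) _ _ (by
      have h := hτ (λ_ x).hom
      have h₁ : ε j ▷ i.obj x ≫ j.obj (𝟙_ D) ◁ τ x ≫ j.map εF ▷ _ =
          ε i ▷ i.obj x ≫ (τ (𝟙_ C) ⊗ₘ τ x) := by
        simp only [← id_tensorHom, ← tensorHom_id, tensorHom_comp_tensorHom, hε, Category.id_comp,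
          Category.comp_id]
      simp only [Category.assoc, Functor.map_comp, ← μ_natural_left_assoc]
      rw [reassoc_of% h₁, reassoc_of% hμ, ← h, ← left_unitality_assoc, ← whisker_exchange_assoc]
      rw [← left_unitality]
      simp)
  right_unitality x := hj (_ ◁ ε j ≫ (τ x ▷ j.obj (𝟙_ D)) ≫ μ j _ _) _ _ (by
      have h := hτ (ρ_ x).hom
      have h₁ : i.obj x ◁ ε j ≫ τ x ▷ j.obj (𝟙_ D) ≫ _ ◁ j.map εF =
          i.obj x ◁ ε i ≫ (τ x ⊗ₘ τ (𝟙_ C)) := by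
        simp only [← id_tensorHom, ← tensorHom_id, tensorHom_comp_tensorHom, hε, Category.id_comp,
          Category.comp_id]
      simp only [Category.assoc, Functor.map_comp, ← μ_natural_right_assoc]
      rw [reassoc_of% h₁, reassoc_of% hμ, ← h, ← right_unitality_assoc, whisker_exchange_assoc]
      rw [← right_unitality]
      simp)

/-- A natural transformation is monoidal if, after a separating lax monoidal functor, it becomes
compatible with monoidal transformations from a common source. -/
theorem isMonoidal_of_separates (hj : j.SeparatesByPrecomp) {F G : C ⥤ D} [F.LaxMonoidal]
    [G.LaxMonoidal] (τF : i ⟶ F ⋙ j) (τG : i ⟶ G ⋙ j) [NatTrans.IsMonoidal τF]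
    [NatTrans.IsMonoidal τG] (η : F ⟶ G) (h : ∀ x, τF.app x ≫ j.map (η.app x) = τG.app x) :
    NatTrans.IsMonoidal η where
  unit := hj (ε j) _ _ (by
    have h₁ := NatTrans.IsMonoidal.unit (τ := τF)
    have h₂ := NatTrans.IsMonoidal.unit (τ := τG)
    simp only [comp_ε] at h₁ h₂
    rw [Functor.map_comp, ← reassoc_of% h₁, h, h₂])
  tensor x y := hj ((τF.app x ⊗ₘ τF.app y) ≫ μ j _ _) _ _ (by
    have h₁ := NatTrans.IsMonoidal.tensor (τ := τF) x y
    have h₂ := NatTrans.IsMonoidal.tensor (τ := τG) x y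
    simp only [comp_μ] at h₁ h₂
    simp only [Functor.map_comp, Category.assoc]
    rw [← reassoc_of% h₁, h, h₂, ← h x, ← h y, ← tensorHom_comp_tensorHom_assoc, μ_natural_assoc])

end Transformation

end Separates

end CategoryTheory.Functor

/-! ### Arrows over products -/

theorem isHomLift_comp {B : Type u₁} [Category.{v₁} B] {X : Type u₂} [Category.{v₂} X] {P : X ⥤ B}
    {a b d : B} {x y z : X} {f : a ⟶ b} {g : b ⟶ d} {φ : x ⟶ y} {ψ : y ⟶ z}
    (hφ : P.IsHomLift f φ) (hψ : P.IsHomLift g ψ) : P.IsHomLift (f ≫ g) (φ ≫ ψ) :=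
  inferInstance

namespace IsCartesianMonoidal

variable {B : Type u₁} [Category.{v₁} B] {X : Type u₂} [Category.{v₂} X]
  [CartesianMonoidalCategory B] [CartesianMonoidalCategory X] (P : X ⥤ B) [IsCartesianMonoidal P]

theorem isHomLift_fst' {a b : B} {x y : X} (hx : P.obj x = a) (hy : P.obj y = b) :
    P.IsHomLift (fst a b) (fst x y) := by
  subst hx hy
  exact isHomLift_fst x y

theorem isHomLift_snd' {a b : B} {x y : X} (hx : P.obj x = a) (hy : P.obj y = b) :
    P.IsHomLift (snd a b) (snd x y) := by
  subst hx hy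
  exact isHomLift_snd x y

/-- Pairings lie over pairings: this is where strict preservation of the projections enters. -/
theorem isHomLift_lift {r a b : B} {w x y : X} {f : r ⟶ a} {g : r ⟶ b} {φ : w ⟶ x} {ψ : w ⟶ y}
    (hφ : P.IsHomLift f φ) (hψ : P.IsHomLift g ψ) : P.IsHomLift (lift f g) (lift φ ψ) := by
  obtain ⟨⟩ := IsHomLift.domain_eq P f φ
  obtain ⟨⟩ := IsHomLift.codomain_eq P f φ
  obtain ⟨⟩ := IsHomLift.codomain_eq P g ψ
  have h₁ := isHomLift_fst (P := P) x y
  have h₂ := isHomLift_snd (P := P) x y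
  refine IsHomLift.of_fac P _ _ rfl (obj_tensor P x y) ?_
  apply CartesianMonoidalCategory.hom_ext
  · rw [lift_fst, IsHomLift.eq_of_isHomLift P f φ,
      IsHomLift.fac P (fst (P.obj x) (P.obj y)) (fst x y)]
    simp [← P.map_comp]
  · rw [lift_snd, IsHomLift.eq_of_isHomLift P g ψ,
      IsHomLift.fac P (snd (P.obj x) (P.obj y)) (snd x y)]
    simp [← P.map_comp]

theorem isHomLift_tensorHom {a a' b b' : B} {x x' y y' : X} {f : a ⟶ a'} {g : b ⟶ b'}
    {φ : x ⟶ x'} {ψ : y ⟶ y'} (hφ : P.IsHomLift f φ) (hψ : P.IsHomLift g ψ) :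
    P.IsHomLift (f ⊗ₘ g) (φ ⊗ₘ ψ) := by
  have h₁ := isHomLift_fst' P (IsHomLift.domain_eq P f φ) (IsHomLift.domain_eq P g ψ)
  have h₂ := isHomLift_snd' P (IsHomLift.domain_eq P f φ) (IsHomLift.domain_eq P g ψ)
  have : f ⊗ₘ g = lift (fst a b ≫ f) (snd a b ≫ g) := by ext <;> simp
  rw [this]
  have : φ ⊗ₘ ψ = lift (fst x y ≫ φ) (snd x y ≫ ψ) := by ext <;> simp
  rw [this]
  exact isHomLift_lift P inferInstance inferInstance

theorem isHomLift_whiskerRight {a a' b : B} {x x' y : X} {f : a ⟶ a'} {φ : x ⟶ x'}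
    (hφ : P.IsHomLift f φ) (hy : P.obj y = b) : P.IsHomLift (f ▷ b) (φ ▷ y) := by
  rw [← tensorHom_id, ← tensorHom_id]
  exact isHomLift_tensorHom P hφ (IsHomLift.id hy)

theorem isHomLift_whiskerLeft {a a' b : B} {x x' y : X} {f : a ⟶ a'} {φ : x ⟶ x'}
    (hφ : P.IsHomLift f φ) (hy : P.obj y = b) : P.IsHomLift (b ◁ f) (y ◁ φ) := by
  rw [← id_tensorHom, ← id_tensorHom]
  exact isHomLift_tensorHom P (IsHomLift.id hy) hφ

theorem obj_tensor' {a b : B} {x y : X} (hx : P.obj x = a) (hy : P.obj y = b) :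
    P.obj (x ⊗ y) = a ⊗ b := by
  subst hx hy
  exact obj_tensor P x y

theorem isHomLift_associator {a b d : B} {x y z : X} (hx : P.obj x = a) (hy : P.obj y = b)
    (hz : P.obj z = d) : P.IsHomLift (α_ a b d).hom (α_ x y z).hom := by
  have h₁ := isHomLift_fst' P (obj_tensor' P hx hy) hz
  have h₂ := isHomLift_snd' P (obj_tensor' P hx hy) hz
  have h₃ := isHomLift_fst' P hx hy
  have h₄ := isHomLift_snd' P hx hy
  have : (α_ a b d).hom = lift (fst _ _ ≫ fst _ _) (lift (fst _ _ ≫ snd _ _) (snd _ _)) := by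
    ext <;> simp
  rw [this]
  have : (α_ x y z).hom = lift (fst _ _ ≫ fst _ _) (lift (fst _ _ ≫ snd _ _) (snd _ _)) := by
    ext <;> simp
  rw [this]
  exact isHomLift_lift P inferInstance (isHomLift_lift P inferInstance inferInstance)

theorem isHomLift_leftUnitor {a : B} {x : X} (hx : P.obj x = a) :
    P.IsHomLift (λ_ a).hom (λ_ x).hom := by
  rw [leftUnitor_hom, leftUnitor_hom]
  exact isHomLift_snd' P obj_unit hx

theorem isHomLift_rightUnitor {a : B} {x : X} (hx : P.obj x = a) :
    P.IsHomLift (ρ_ a).hom (ρ_ x).hom := by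
  rw [rightUnitor_hom, rightUnitor_hom]
  exact isHomLift_fst' P hx obj_unit

theorem isHomLift_swap {a b : B} {x y : X} (hx : P.obj x = a) (hy : P.obj y = b) :
    P.IsHomLift (lift (snd a b) (fst a b)) (lift (snd x y) (fst x y)) :=
  isHomLift_lift P (isHomLift_snd' P hx hy) (isHomLift_fst' P hx hy)

theorem isHomLift_toUnit {a : B} {x : X} (hx : P.obj x = a) :
    P.IsHomLift (toUnit a) (toUnit x) :=
  IsHomLift.of_fac P _ _ hx obj_unit (toUnit_unique _ _)

end IsCartesianMonoidal

/-! ### The addition of an object of an additive category -/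

section Addition

variable {B : Type u₁} [Category.{v₁} B] [Preadditive B] [CartesianMonoidalCategory B]

/-- The addition `m : a ⊗ a ⟶ a` of an object of an additive category. -/
abbrev addition (a : B) : a ⊗ a ⟶ a := fst a a + snd a a

theorem lift_addition {a b : B} (f g : a ⟶ b) : lift f g ≫ addition b = f + g := by
  simp

theorem addition_assoc (a : B) :
    (α_ a a a).hom ≫ a ◁ addition a ≫ addition a = addition a ▷ a ≫ addition a := by
  simp [add_assoc]

theorem zero_addition (a : B) : (0 : 𝟙_ B ⟶ a) ▷ a ≫ addition a = (λ_ a).hom := by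
  simp [leftUnitor_hom]

theorem addition_zero (a : B) : a ◁ (0 : 𝟙_ B ⟶ a) ≫ addition a = (ρ_ a).hom := by
  simp [rightUnitor_hom]

theorem swap_addition (a : B) : lift (snd a a) (fst a a) ≫ addition a = addition a := by
  simp [add_comm]

theorem addition_comp {a b : B} (f : a ⟶ b) : addition a ≫ f = (f ⊗ₘ f) ≫ addition b := by
  simp

end Addition

/-! ### Opfibrations fibred in groupoids -/

namespace OpCleavage

section Groupoid

variable {B : Type u₁} [Category.{v₁} B] {X : Type u₂} [Category.{v₂} X] {P : X ⥤ B}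
  (c : OpCleavage P) [∀ a, IsGroupoid (P.Fiber a)]

include c

/-- In an opfibration fibred in groupoids every arrow is cocartesian: it is a chosen lifting
followed by a vertical isomorphism. -/
theorem isStronglyCocartesian_of_isHomLift {a b : B} {x y : X} {f : a ⟶ b} {φ : x ⟶ y}
    (hφ : P.IsHomLift f φ) : P.IsStronglyCocartesian f φ := by
  let x' : P.Fiber a := ⟨x, IsHomLift.domain_eq P f φ⟩
  let y' : P.Fiber b := ⟨y, IsHomLift.codomain_eq P f φ⟩
  let v : c.obj f x' ⟶ y' := c.desc f x' (y := y') φ hφ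
  have h : c.lift f x' ≫ (fibreIncl P b).map v = φ := c.lift_desc f x' (y := y') φ hφ
  have : P.IsStronglyCocartesian (𝟙 b) ((fibreIncl P b).map v) :=
    Functor.IsStronglyCocartesian.of_isIso P _ _
  have : P.IsStronglyCocartesian (f ≫ 𝟙 b) (c.lift f x' ≫ (fibreIncl P b).map v) := inferInstance
  rwa [h, Category.comp_id] at this

/-- Vertical arrows can be compared after precomposition with any single arrow of `X`, as that arrow
is cocartesian. -/
theorem separatesByPrecomp (a : B) : (fibreIncl P a).SeparatesByPrecomp := by
  intro w y z φ α β h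
  have : P.IsHomLift (P.map φ ≫ eqToHom y.2) φ :=
    IsHomLift.of_fac P _ _ rfl y.2 (by simp)
  have := c.isStronglyCocartesian_of_isHomLift this
  exact Functor.Fiber.hom_ext
    (Functor.IsStronglyCocartesian.ext P (P.map φ ≫ eqToHom y.2) φ (𝟙 a) h)

/-- The vertical arrow through which one arrow factors through another over the same arrow of the
base, in an opfibration fibred in groupoids. -/
noncomputable def factor {r a : B} {w : X} {y z : P.Fiber a} {f : r ⟶ a}
    (φ : w ⟶ (fibreIncl P a).obj y) (ψ : w ⟶ (fibreIncl P a).obj z) (hφ : P.IsHomLift f φ)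
    (hψ : P.IsHomLift f ψ) : y ⟶ z :=
  have := c.isStronglyCocartesian_of_isHomLift hφ
  vertical (Functor.IsStronglyCocartesian.map P f φ (Category.comp_id f).symm ψ) inferInstance

theorem comp_factor {r a : B} {w : X} {y z : P.Fiber a} {f : r ⟶ a}
    (φ : w ⟶ (fibreIncl P a).obj y) (ψ : w ⟶ (fibreIncl P a).obj z) (hφ : P.IsHomLift f φ)
    (hψ : P.IsHomLift f ψ) : φ ≫ (fibreIncl P a).map (c.factor φ ψ hφ hψ) = ψ :=
  have := c.isStronglyCocartesian_of_isHomLift hφ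
  Functor.IsStronglyCocartesian.fac P f φ (Category.comp_id f).symm ψ

end Groupoid

variable {B : Type u₁} [Category.{v₁} B] [Preadditive B] [CartesianMonoidalCategory B]
  {X : Type u₂} [Category.{v₂} X] [CartesianMonoidalCategory X] {P : X ⥤ B}
  [IsCartesianMonoidal P] (c : OpCleavage P)

open IsCartesianMonoidal

/-! ### The tensor product of a fibre -/

/-- The tensor product `m_* (x × y)` of two objects of a fibre. -/
def tensor {a : B} (x y : P.Fiber a) : P.Fiber a := c.obj (addition a) (fibreProd x y)

/-- The chosen lifting `x × y ⟶ x ⊗ y` of the addition. -/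
def tensorLift {a : B} (x y : P.Fiber a) :
    (fibreIncl P a).obj x ⊗ (fibreIncl P a).obj y ⟶ (fibreIncl P a).obj (c.tensor x y) :=
  c.lift (addition a) (fibreProd x y)

/-- The unit object `e_* I` of a fibre. -/
def unit (a : B) : P.Fiber a := c.obj (0 : 𝟙_ B ⟶ a) (fibreUnit P)

/-- The chosen lifting `I ⟶ e_* I` of the zero. -/
def unitLift (a : B) : 𝟙_ X ⟶ (fibreIncl P a).obj (c.unit a) :=
  c.lift (0 : 𝟙_ B ⟶ a) (fibreUnit P)

theorem isHomLift_tensorLift {a : B} (x y : P.Fiber a) :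
    P.IsHomLift (addition a) (c.tensorLift x y) :=
  (c.isCocartesian (addition a) (fibreProd x y)).toIsHomLift

theorem isHomLift_unitLift (a : B) : P.IsHomLift (0 : 𝟙_ B ⟶ a) (c.unitLift a) :=
  (c.isCocartesian (0 : 𝟙_ B ⟶ a) (fibreUnit P)).toIsHomLift

theorem isHomLift_map_tensorHom_comp {a : B} {x x' y y' : P.Fiber a} (f : x ⟶ x') (g : y ⟶ y')
    {z : X} (φ : (fibreIncl P a).obj x' ⊗ (fibreIncl P a).obj y' ⟶ z)
    (hφ : P.IsHomLift (addition a) φ) :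
    P.IsHomLift (addition a) (((fibreIncl P a).map f ⊗ₘ (fibreIncl P a).map g) ≫ φ) := by
  have h := isHomLift_comp (isHomLift_tensorHom P f.2 g.2) hφ
  rwa [id_tensorHom_id, Category.id_comp] at h

theorem isHomLift_whiskerRight_tensorLift_comp {a : B} (x y z : P.Fiber a) {w : X}
    (φ : (fibreIncl P a).obj (c.tensor x y) ⊗ (fibreIncl P a).obj z ⟶ w)
    (hφ : P.IsHomLift (addition a) φ) :
    P.IsHomLift (addition a ▷ a ≫ addition a) (c.tensorLift x y ▷ (fibreIncl P a).obj z ≫ φ) :=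
  isHomLift_comp (isHomLift_whiskerRight P (c.isHomLift_tensorLift x y) z.2) hφ

theorem isHomLift_associator_comp {a : B} (x y z : P.Fiber a) {w : X}
    (φ : (fibreIncl P a).obj x ⊗ (fibreIncl P a).obj (c.tensor y z) ⟶ w)
    (hφ : P.IsHomLift (addition a) φ) :
    P.IsHomLift (addition a ▷ a ≫ addition a)
      ((α_ ((fibreIncl P a).obj x) ((fibreIncl P a).obj y) ((fibreIncl P a).obj z)).hom ≫
        (fibreIncl P a).obj x ◁ c.tensorLift y z ≫ φ) := by
  rw [← addition_assoc]
  exact isHomLift_comp (isHomLift_associator P x.2 y.2 z.2)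
    (isHomLift_comp (isHomLift_whiskerLeft P (c.isHomLift_tensorLift y z) x.2) hφ)

theorem isHomLift_unitLift_whiskerRight_comp {a : B} (x : P.Fiber a) {w : X}
    (φ : (fibreIncl P a).obj (c.unit a) ⊗ (fibreIncl P a).obj x ⟶ w)
    (hφ : P.IsHomLift (addition a) φ) :
    P.IsHomLift (λ_ a).hom (c.unitLift a ▷ (fibreIncl P a).obj x ≫ φ) := by
  rw [← zero_addition]
  exact isHomLift_comp (isHomLift_whiskerRight P (c.isHomLift_unitLift a) x.2) hφ

theorem isHomLift_whiskerLeft_unitLift_comp {a : B} (x : P.Fiber a) {w : X}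
    (φ : (fibreIncl P a).obj x ⊗ (fibreIncl P a).obj (c.unit a) ⟶ w)
    (hφ : P.IsHomLift (addition a) φ) :
    P.IsHomLift (ρ_ a).hom ((fibreIncl P a).obj x ◁ c.unitLift a ≫ φ) := by
  rw [← addition_zero]
  exact isHomLift_comp (isHomLift_whiskerLeft P (c.isHomLift_unitLift a) x.2) hφ

variable [∀ a, IsGroupoid (P.Fiber a)]

/-- The tensor product of vertical arrows. -/
noncomputable def tensorMap {a : B} {x x' y y' : P.Fiber a} (f : x ⟶ x') (g : y ⟶ y') :
    c.tensor x y ⟶ c.tensor x' y' :=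
  c.factor (c.tensorLift x y)
    (((fibreIncl P a).map f ⊗ₘ (fibreIncl P a).map g) ≫ c.tensorLift x' y')
    (c.isHomLift_tensorLift x y)
    (isHomLift_map_tensorHom_comp f g _ (c.isHomLift_tensorLift x' y'))

theorem tensorLift_tensorMap {a : B} {x x' y y' : P.Fiber a} (f : x ⟶ x') (g : y ⟶ y') :
    c.tensorLift x y ≫ (fibreIncl P a).map (c.tensorMap f g) =
      ((fibreIncl P a).map f ⊗ₘ (fibreIncl P a).map g) ≫ c.tensorLift x' y' :=
  c.comp_factor _ _ _ _

/-- The associativity constraint of a fibre; both legs lie over the threefold addition. -/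
noncomputable def assocHom {a : B} (x y z : P.Fiber a) :
    c.tensor (c.tensor x y) z ⟶ c.tensor x (c.tensor y z) :=
  c.factor _ _ (c.isHomLift_whiskerRight_tensorLift_comp x y z _ (c.isHomLift_tensorLift _ _))
    (c.isHomLift_associator_comp x y z _ (c.isHomLift_tensorLift _ _))

theorem tensorLift_assocHom {a : B} (x y z : P.Fiber a) :
    c.tensorLift x y ▷ (fibreIncl P a).obj z ≫ c.tensorLift (c.tensor x y) z ≫
        (fibreIncl P a).map (c.assocHom x y z) =
      (α_ ((fibreIncl P a).obj x) ((fibreIncl P a).obj y) ((fibreIncl P a).obj z)).hom ≫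
        (fibreIncl P a).obj x ◁ c.tensorLift y z ≫ c.tensorLift x (c.tensor y z) :=
  (Category.assoc _ _ _).symm.trans (c.comp_factor _ _
        (c.isHomLift_whiskerRight_tensorLift_comp x y z _ (c.isHomLift_tensorLift _ _))
        (c.isHomLift_associator_comp x y z _ (c.isHomLift_tensorLift _ _)))

/-- The left unit constraint of a fibre; both legs lie over `0 + _`. -/
noncomputable def leftUnitHom {a : B} (x : P.Fiber a) : c.tensor (c.unit a) x ⟶ x :=
  c.factor _ _ (c.isHomLift_unitLift_whiskerRight_comp x _ (c.isHomLift_tensorLift _ _))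
    (isHomLift_leftUnitor P x.2)

theorem unitLift_leftUnitHom {a : B} (x : P.Fiber a) :
    c.unitLift a ▷ (fibreIncl P a).obj x ≫ c.tensorLift (c.unit a) x ≫
      (fibreIncl P a).map (c.leftUnitHom x) = (λ_ ((fibreIncl P a).obj x)).hom :=
  (Category.assoc _ _ _).symm.trans (c.comp_factor _ _
        (c.isHomLift_unitLift_whiskerRight_comp x _ (c.isHomLift_tensorLift _ _))
        (isHomLift_leftUnitor P x.2))

/-- The right unit constraint of a fibre; both legs lie over `_ + 0`. -/
noncomputable def rightUnitHom {a : B} (x : P.Fiber a) : c.tensor x (c.unit a) ⟶ x :=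
  c.factor _ _ (c.isHomLift_whiskerLeft_unitLift_comp x _ (c.isHomLift_tensorLift _ _))
    (isHomLift_rightUnitor P x.2)

theorem unitLift_rightUnitHom {a : B} (x : P.Fiber a) :
    (fibreIncl P a).obj x ◁ c.unitLift a ≫ c.tensorLift x (c.unit a) ≫
      (fibreIncl P a).map (c.rightUnitHom x) = (ρ_ ((fibreIncl P a).obj x)).hom :=
  (Category.assoc _ _ _).symm.trans (c.comp_factor _ _
        (c.isHomLift_whiskerLeft_unitLift_comp x _ (c.isHomLift_tensorLift _ _))
        (isHomLift_rightUnitor P x.2))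

/-- The data of the canonical monoidal structure of a fibre: the tensor product is `m_* (x × y)` and
the unit is `e_* I`. -/
noncomputable abbrev fibreMonoidalCategoryStruct (a : B) : MonoidalCategoryStruct (P.Fiber a) where
  tensorObj := c.tensor
  whiskerLeft x _ _ f := c.tensorMap (𝟙 x) f
  whiskerRight f z := c.tensorMap f (𝟙 z)
  tensorHom := c.tensorMap
  tensorUnit := c.unit a
  associator x y z := asIso (c.assocHom x y z)
  leftUnitor x := asIso (c.leftUnitHom x)
  rightUnitor x := asIso (c.rightUnitHom x)

/-- The canonical monoidal structure of a fibre. -/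
noncomputable abbrev fibreMonoidalCategory (a : B) : MonoidalCategory (P.Fiber a) :=
  letI := c.fibreMonoidalCategoryStruct a
  Functor.monoidalCategoryOfSeparates (c.separatesByPrecomp a) (c.unitLift a) c.tensorLift
    (fun _ _ _ _ => rfl) (fun _ _ => rfl) c.tensorLift_tensorMap
    c.tensorLift_assocHom
    c.unitLift_leftUnitHom
    c.unitLift_rightUnitHom

/-- The inclusion of a fibre, with its canonical monoidal structure, is lax monoidal by means of the
chosen liftings of the addition and the zero. -/
noncomputable abbrev fibreInclLaxMonoidal (a : B) :
    letI := c.fibreMonoidalCategory a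
    (fibreIncl P a).LaxMonoidal :=
  letI := c.fibreMonoidalCategory a
  { ε := c.unitLift a
    μ := c.tensorLift
    μ_natural_left := fun f z => by
      have := c.tensorLift_tensorMap f (𝟙 z)
      rw [CategoryTheory.Functor.map_id, tensorHom_id] at this
      exact this.symm
    μ_natural_right := fun z f => by
      have := c.tensorLift_tensorMap (𝟙 z) f
      rw [CategoryTheory.Functor.map_id, id_tensorHom] at this
      exact this.symm
    associativity := c.tensorLift_assocHom
    left_unitality := fun x => (c.unitLift_leftUnitHom x).symm
    right_unitality := fun x => (c.unitLift_rightUnitHom x).symm }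

end OpCleavage

namespace OpCleavage

open IsCartesianMonoidal Functor.LaxMonoidal

/-! ### Additive lax monoidal structures on the inclusions of the fibres -/

section Additive

variable {B : Type u₁} [Category.{v₁} B] [Preadditive B] [CartesianMonoidalCategory B]
  {X : Type u₂} [Category.{v₂} X] [CartesianMonoidalCategory X] {P : X ⥤ B}
  [∀ a, MonoidalCategory (P.Fiber a)] [∀ a, (fibreIncl P a).LaxMonoidal]

variable (P) in
/-- The structure maps of the lax monoidal inclusions of the fibres lie over the zeros and the
additions of the objects of the base. -/
structure LiftsAddition : Prop where
  isHomLift_ε (a : B) : P.IsHomLift (0 : 𝟙_ B ⟶ a) (ε (fibreIncl P a))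
  isHomLift_μ {a : B} (x y : P.Fiber a) : P.IsHomLift (addition a) (μ (fibreIncl P a) x y)

variable [IsCartesianMonoidal P] (c : OpCleavage P) [∀ a, IsGroupoid (P.Fiber a)]
  (h : LiftsAddition P)

include c h

/-- The symmetry of a fibre; it exists because addition is commutative. -/
noncomputable def braidHom {a : B} (x y : P.Fiber a) : x ⊗ y ⟶ y ⊗ x :=
  c.factor (μ (fibreIncl P a) x y)
    (CartesianMonoidalCategory.lift (snd _ _) (fst _ _) ≫ μ (fibreIncl P a) y x)
    (h.isHomLift_μ x y) (by
      rw [← swap_addition]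
      exact isHomLift_comp (isHomLift_swap P x.2 y.2) (h.isHomLift_μ y x))

theorem μ_braidHom {a : B} (x y : P.Fiber a) :
    μ (fibreIncl P a) x y ≫ (fibreIncl P a).map (c.braidHom h x y) =
      CartesianMonoidalCategory.lift (snd _ _) (fst _ _) ≫ μ (fibreIncl P a) y x :=
  c.comp_factor _ _ _ _

/-- The symmetric monoidal structure of a fibre. The symmetry of `X` used to verify the axioms is
the one with components `lift (snd _ _) (fst _ _)`. -/
noncomputable abbrev fibreSymmetricCategory (a : B) : SymmetricCategory (P.Fiber a) :=
  letI : BraidedCategory X := .ofCartesianMonoidalCategory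
  letI : SymmetricCategory X := { }
  Functor.symmetricCategoryOfSeparates (i := fibreIncl P a) (c.separatesByPrecomp a)
    (fun x y => asIso (c.braidHom h x y)) (c.μ_braidHom h)

omit [IsCartesianMonoidal P] [∀ a, IsGroupoid (P.Fiber a)] in
theorem isHomLift_ε_cart {a b : B} (f : a ⟶ b) :
    P.IsHomLift (0 : 𝟙_ B ⟶ b) (ε (fibreIncl P a) ≫ c.cart f (𝟙_ (P.Fiber a))) := by
  have := isHomLift_comp (h.isHomLift_ε a) (c.isCocartesian f (𝟙_ (P.Fiber a))).toIsHomLift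
  rwa [Limits.zero_comp] at this

omit [∀ a, IsGroupoid (P.Fiber a)] in
/-- Both sides of the tensor comparison of `f_*` lie over the same arrow, because every arrow of an
additive category is a homomorphism for the additions. -/
theorem isHomLift_cart_μ {a b : B} (f : a ⟶ b) (x y : P.Fiber a) :
    P.IsHomLift (addition a ≫ f) ((c.cart f x ⊗ₘ c.cart f y) ≫
      μ (fibreIncl P b) ((c.push f).obj x) ((c.push f).obj y)) := by
  rw [addition_comp]
  exact isHomLift_comp (isHomLift_tensorHom P (c.isCocartesian f x).toIsHomLift
    (c.isCocartesian f y).toIsHomLift) (h.isHomLift_μ _ _)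

omit [IsCartesianMonoidal P] [∀ a, IsGroupoid (P.Fiber a)] in
theorem isHomLift_μ_cart {a b : B} (f : a ⟶ b) (x y : P.Fiber a) :
    P.IsHomLift (addition a ≫ f) (μ (fibreIncl P a) x y ≫ c.cart f (x ⊗ y)) :=
  isHomLift_comp (h.isHomLift_μ x y) (c.isCocartesian f (x ⊗ y)).toIsHomLift

/-- The unit comparison `e_* I ⟶ f_* (e_* I)` of a change of base functor. -/
noncomputable def pushUnit {a b : B} (f : a ⟶ b) :
    𝟙_ (P.Fiber b) ⟶ (c.push f).obj (𝟙_ (P.Fiber a)) :=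
  c.factor _ _ (h.isHomLift_ε b) (c.isHomLift_ε_cart h f)

omit [IsCartesianMonoidal P] in
theorem ε_pushUnit {a b : B} (f : a ⟶ b) :
    ε (fibreIncl P b) ≫ (fibreIncl P b).map (c.pushUnit h f) =
      ε (fibreIncl P a) ≫ c.cart f (𝟙_ (P.Fiber a)) :=
  c.comp_factor _ _ _ _

/-- The tensor comparison `f_* x ⊗ f_* y ⟶ f_* (x ⊗ y)` of a change of base functor. -/
noncomputable def pushTensor {a b : B} (f : a ⟶ b) (x y : P.Fiber a) :
    (c.push f).obj x ⊗ (c.push f).obj y ⟶ (c.push f).obj (x ⊗ y) :=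
  c.factor _ _ (c.isHomLift_cart_μ h f x y) (c.isHomLift_μ_cart h f x y)

theorem μ_pushTensor {a b : B} (f : a ⟶ b) (x y : P.Fiber a) :
    (c.cart f x ⊗ₘ c.cart f y) ≫ μ (fibreIncl P b) ((c.push f).obj x) ((c.push f).obj y) ≫
      (fibreIncl P b).map (c.pushTensor h f x y) =
        μ (fibreIncl P a) x y ≫ c.cart f (x ⊗ y) :=
  (Category.assoc _ _ _).symm.trans (c.comp_factor _ _ _ _)

/-- The lax monoidal structure of a change of base functor. -/
noncomputable abbrev pushLaxMonoidal {a b : B} (f : a ⟶ b) : (c.push f).LaxMonoidal :=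
  Functor.laxMonoidalOfSeparates (c.separatesByPrecomp b) (c.cart f)
    (fun g => (c.cart_map f g).symm) (c.pushUnit h f) (c.pushTensor h f) (c.ε_pushUnit h f)
    (c.μ_pushTensor h f)

/-- The strong monoidal structure of a change of base functor: the comparison maps are invertible
since the fibres are groupoids. -/
noncomputable abbrev pushMonoidal {a b : B} (f : a ⟶ b) : (c.push f).Monoidal :=
  letI := c.pushLaxMonoidal h f
  Functor.Monoidal.ofLaxMonoidal (c.push f)

theorem liftNat_isMonoidal_of_liftsAddition {a b : B} (f : a ⟶ b) :
    letI := c.pushMonoidal h f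
    NatTrans.IsMonoidal (c.liftNat f) :=
  letI := c.pushMonoidal h f
  { unit := (c.ε_pushUnit h f).symm
    tensor := fun x y => (c.μ_pushTensor h f x y).symm }

/-- Every object of a fibre has the inverse `(-1)_* x`: both `x ⊗ (-1)_* x` and the unit are
codomains of liftings of the zero endomorphism at `x`. -/
theorem exists_tensor_inverse {a : B} (x : P.Fiber a) :
    ∃ y : P.Fiber a, Nonempty (x ⊗ y ≅ 𝟙_ (P.Fiber a)) ∧ Nonempty (y ⊗ x ≅ 𝟙_ (P.Fiber a)) := by
  have hn : P.IsHomLift (-𝟙 a) (c.cart (-𝟙 a) x) := (c.isCocartesian (-𝟙 a) x).toIsHomLift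
  have hi : P.IsHomLift (𝟙 a) (𝟙 ((fibreIncl P a).obj x)) := IsHomLift.id x.2
  have h₀ := isHomLift_comp (isHomLift_toUnit P x.2) (h.isHomLift_ε a)
  have h₁ := isHomLift_comp (isHomLift_lift P hi hn) (h.isHomLift_μ x ((c.push (-𝟙 a)).obj x))
  have h₂ := isHomLift_comp (isHomLift_lift P hn hi) (h.isHomLift_μ ((c.push (-𝟙 a)).obj x) x)
  rw [Limits.comp_zero] at h₀
  rw [lift_addition, add_neg_cancel] at h₁
  rw [lift_addition, neg_add_cancel] at h₂
  exact ⟨(c.push (-𝟙 a)).obj x, ⟨asIso (c.factor _ _ h₁ h₀)⟩, ⟨asIso (c.factor _ _ h₂ h₀)⟩⟩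

end Additive

/-! ### Symmetric monoidal change of base -/

section Symmetric

variable {B : Type u₁} [Category.{v₁} B]
  {X : Type u₂} [Category.{v₂} X] [CartesianMonoidalCategory X] {P : X ⥤ B}
  [∀ a, MonoidalCategory (P.Fiber a)] [∀ a, (fibreIncl P a).LaxMonoidal]
  [∀ a, SymmetricCategory (P.Fiber a)] (c : OpCleavage P) [∀ a, IsGroupoid (P.Fiber a)]

/-- A monoidal structure on a change of base functor for which the chosen liftings are monoidal is
braided, when the symmetries of the fibres come from those of the products. -/
abbrev pushBraided {a b : B} (f : a ⟶ b) [(c.push f).Monoidal]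
    [NatTrans.IsMonoidal (c.liftNat f)]
    (hβ : ∀ (a : B) (x y : P.Fiber a),
      μ (fibreIncl P a) x y ≫ (fibreIncl P a).map (β_ x y).hom =
        CartesianMonoidalCategory.lift (snd _ _) (fst _ _) ≫ μ (fibreIncl P a) y x) :
    (c.push f).Braided where
  braided x y := c.separatesByPrecomp b ((c.cart f x ⊗ₘ c.cart f y) ≫ μ (fibreIncl P b) _ _) _ _ (by
    have h : ∀ x y, (c.cart f x ⊗ₘ c.cart f y) ≫ μ (fibreIncl P b) _ _ ≫
        (fibreIncl P b).map (μ (c.push f) x y) = μ (fibreIncl P a) x y ≫ c.cart f (x ⊗ y) :=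
      fun x y => (NatTrans.IsMonoidal.tensor (τ := c.liftNat f) x y).symm
    have hs : (c.cart f x ⊗ₘ c.cart f y) ≫ CartesianMonoidalCategory.lift (snd _ _) (fst _ _) =
        CartesianMonoidalCategory.lift (snd _ _) (fst _ _) ≫ (c.cart f y ⊗ₘ c.cart f x) := by
      ext <;> simp
    simp only [Functor.map_comp, Category.assoc]
    rw [reassoc_of% h, c.cart_map, reassoc_of% hβ, reassoc_of% hβ, reassoc_of% hs, h])

variable [∀ {a b : B} (f : a ⟶ b), (c.push f).Braided]
  (hl : ∀ {a b : B} (f : a ⟶ b), NatTrans.IsMonoidal (c.liftNat f))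

include hl

/-- The isomorphism `(𝟙 a)_* ≅ 𝟭` turns the liftings of `𝟙 a` into identities, so it is monoidal as
soon as the chosen liftings are. -/
theorem pushId_isMonoidal_of_liftNat (a : B) : NatTrans.IsMonoidal (c.pushId a).hom :=
  have := hl (𝟙 a)
  let τ : fibreIncl P a ⟶ 𝟭 (P.Fiber a) ⋙ fibreIncl P a := (Functor.leftUnitor _).inv
  have : NatTrans.IsMonoidal τ := inferInstance
  Functor.isMonoidal_of_separates (c.separatesByPrecomp a) (c.liftNat (𝟙 a)) τ _ (c.cart_pushId a)

/-- The isomorphism `(f ≫ g)_* ≅ f_* ⋙ g_*` turns the liftings of `f ≫ g` into composites of the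
liftings of `f` and of `g`, so it is monoidal as soon as the chosen liftings are. -/
theorem pushComp_isMonoidal_of_liftNat {a b d : B} (f : a ⟶ b) (g : b ⟶ d) :
    NatTrans.IsMonoidal (c.pushComp f g).hom :=
  have := hl f
  have := hl g
  have := hl (f ≫ g)
  let τ : fibreIncl P a ⟶ (c.push f ⋙ c.push g) ⋙ fibreIncl P d :=
    c.liftNat f ≫ Functor.whiskerLeft (c.push f) (c.liftNat g) ≫ (Functor.associator _ _ _).inv
  have : NatTrans.IsMonoidal τ := inferInstance
  Functor.isMonoidal_of_separates (c.separatesByPrecomp d) (c.liftNat (f ≫ g)) τ _ (fun x => by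
    refine (c.cart_pushComp f g x).trans (congrArg (c.cart f x ≫ ·) ?_)
    exact (Category.comp_id _).symm)

end Symmetric

/-! ### Factorizations through symmetric 2-groups -/

theorem isGroupoid_of_factorsThroughSCG {B : Type u₁} [Category.{v₁} B] {X : Type u₂}
    [Category.{v₂} X] {P : X ⥤ B} (c : OpCleavage P) (h : c.FactorsThroughSCG) (a : B) :
    IsGroupoid (P.Fiber a) := by
  obtain ⟨G, hG⟩ := h
  have e : Cat.of (G.obj ⟨a⟩).carrier = Cat.of (P.Fiber a) :=
    congrArg (fun F : Pseudofunctor (LocallyDiscrete B) Cat.{v₂, u₂} => F.obj ⟨a⟩) hG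
  have h' : IsGroupoid (Cat.of (G.obj ⟨a⟩).carrier) := (G.obj ⟨a⟩).isGroupoid
  rw [e] at h'
  exact h'

section Canonical

variable {B : Type u₁} [Category.{v₁} B] [Preadditive B] [CartesianMonoidalCategory B]
  {X : Type u₂} [Category.{v₂} X] [CartesianMonoidalCategory X] {P : X ⥤ B}
  [IsCartesianMonoidal P] (c : OpCleavage P)

/-- Fibrewise groupoids carry the canonical structures, which assemble to a pseudofunctor with
values in symmetric 2-groups. -/
theorem factorsCanonicallyThroughSCG_of_isGroupoid (hG : ∀ a, IsGroupoid (P.Fiber a)) :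
    c.FactorsCanonicallyThroughSCG := by
  let _ : ∀ a, MonoidalCategory (P.Fiber a) := c.fibreMonoidalCategory
  let _ : ∀ a, (fibreIncl P a).LaxMonoidal := c.fibreInclLaxMonoidal
  have h : LiftsAddition P := ⟨c.isHomLift_unitLift, c.isHomLift_tensorLift⟩
  let _ : ∀ a, SymmetricCategory (P.Fiber a) := c.fibreSymmetricCategory h
  have hβ := fun (a : B) (x y : P.Fiber a) => c.μ_braidHom h x y
  let _ : ∀ {a b : B} (f : a ⟶ b), (c.push f).Braided := fun f =>
    letI := c.pushMonoidal h f
    have := c.liftNat_isMonoidal_of_liftsAddition h f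
    c.pushBraided f hβ
  have hl : ∀ {a b : B} (f : a ⟶ b), NatTrans.IsMonoidal (c.liftNat f) :=
    c.liftNat_isMonoidal_of_liftsAddition h
  have hL : c.IsSCGLift := ⟨hG, fun _ => c.exists_tensor_inverse h,
    c.pushId_isMonoidal_of_liftNat hl, c.pushComp_isMonoidal_of_liftNat hl⟩
  exact ⟨inferInstance, inferInstance, inferInstance, inferInstance, hL, hL.toSCG_comp_forget,
    ⟨fun _ => rfl, fun _ _ _ => rfl, hβ, hl⟩⟩

end Canonical

end OpCleavage

theorem theorem5p8 {B : Type u₁} [Category.{v₁} B] [Preadditive B] [CartesianMonoidalCategory B]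
    {X : Type u₂} [Category.{v₂} X] [CartesianMonoidalCategory X] (P : X ⥤ B)
    [IsCartesianMonoidal P] (c : OpCleavage P) :
    (c.FactorsThroughSCG ↔ ∀ a : B, IsGroupoid (P.Fiber a)) ∧
      (c.FactorsCanonicallyThroughSCG ↔ ∀ a : B, IsGroupoid (P.Fiber a)) := by
  refine ⟨⟨c.isGroupoid_of_factorsThroughSCG, fun hG => ?_⟩,
    ⟨fun ⟨_, _, _, _, h, _⟩ => h.isGroupoid, c.factorsCanonicallyThroughSCG_of_isGroupoid⟩⟩
  obtain ⟨_, _, _, _, h, _⟩ := c.factorsCanonicallyThroughSCG_of_isGroupoid hG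
  exact h.factorsThroughSCG
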